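/- Let $(S,\cdot)$ be a semigroup, and let $\beta S$ be the set of ultrafilters on $S$ with the operation given by $A\in p\cdot q \iff \{s\in S: \{t\in S: st\in A\}\in q\}\in p$. Let $\mathcal F$ be a filter on $S$ such that $\bar{\mathcal F}=\bigcap_{V\in\mathcal F}\{p\in\beta S: V\in p\}$ is a subsemigroup of $\beta S$. A subset of $S$ is called $\mathcal F$-central if it belongs to some idempotent lying in the smallest ideal $K(\bar{\mathcal F})$ of $\bar{\mathcal F}$. Let $(C_n)_{n\ge 1}$ be a sequence of sets that are $\mathcal F$-central with respect to one and the same idempotent, that is, there is an idempotent $p\in K(\bar{\mathcal F})$ with $C_n\in p$ for all $n\ge 1$. For $m\in\mathbb N=\{1,2,\dots\}$ let $\mathcal J_m$ be the set of strictly increasing $m$-tuples $t=(t(1)<\dots<t(m))$ of natural numbers, and for $a\in S^{m+1}$, $t\in\mathcal J_m$ and a sequence $f:\mathbb N\to S$ put $$x(m,a,t,f)=a(1)\,f(t(1))\,a(2)\,f(t(2))\cdots a(m)\,f(t(m))\,a(m+1).$$ Let $\mathcal P_f^{\mathcal F}({}^{\mathbb N}S)$ be the set of all nonempty finite sets $F$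 of sequences in $S$ that are $\mathcal F$-good, which means: for every $V\in\mathcal F$ and every $k\in\mathbb N$ there are $m\in\mathbb N$, $a\in S^{m+1}$ and $t\in\mathcal J_m$ with $t(1)>k$ such that $x(m,a,t,f)\in V$ for all $f\in F$. Then one can choose, for every $F\in\mathcal P_f^{\mathcal F}({}^{\mathbb N}S)$, some $m(F)\in\mathbb N$, $\alpha(F)\in S^{m(F)+1}$ and $\tau(F)\in\mathcal J_{m(F)}$ such that 1. if $F,G\in\mathcal P_f^{\mathcal F}({}^{\mathbb N}S)$ and $G\subsetneq F$, then $\tau(G)(m(G))<\tau(F)(1)$; and 2. if $n\in\mathbb N$, $G_1,\dots,G_n\in\mathcal P_f^{\mathcal F}({}^{\mathbb N}S)$, $G_1\subsetneq G_2\subsetneq\dots\subsetneq G_n$, and $f_i\in G_i$ for $i=1,\dots,n$, then, with $r=|G_1|$, the product taken in increasing order of $i$ satisfies $$\prod_{i=1}^{n}x(m(G_i),\alpha(G_i),\tau(G_i),f_i)\in C_r.$$ -/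

import Mathlib

open Filter

attribute [local instance] Ultrafilter.semigroup

namespace FilterCentral

variable {S : Type*}

/-- The closure of a filter `𝓕` on `S` in `βS` (the ultrafilters on `S`): the intersection over
`V ∈ 𝓕` of the basic closed sets `{p | V ∈ p}`. -/
def closure (𝓕 : Filter S) : Set (Ultrafilter S) :=
  ⋂ V ∈ 𝓕, {p : Ultrafilter S | V ∈ p}

/-- `I` is a (nonempty, two-sided) ideal of the subset `T` of a semigroup. -/
structure IsIdealOf {M : Type*} [Semigroup M] (T I : Set M) : Prop where
  subset : I ⊆ T
  nonempty : I.Nonempty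
  mul_left_mem : ∀ t ∈ T, ∀ x ∈ I, t * x ∈ I
  mul_right_mem : ∀ t ∈ T, ∀ x ∈ I, x * t ∈ I

/-- The smallest two-sided ideal `K(T)`: the elements of `T` that lie in every ideal of `T`. -/
def smallestIdeal {M : Type*} [Semigroup M] (T : Set M) : Set M :=
  {p | p ∈ T ∧ ∀ I : Set M, IsIdealOf T I → p ∈ I}

/-- `p` is a minimal idempotent of the closure of `𝓕`: an idempotent in its smallest ideal.
A set is `𝓕`-central iff it belongs to some such `p`. -/
def IsMinimalIdempotent [Semigroup S] (𝓕 : Filter S) (p : Ultrafilter S) : Prop :=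
  p ∈ smallestIdeal (closure 𝓕) ∧ p * p = p

/-- `𝒥 m`: the strictly increasing `m`-tuples `t(1) < ⋯ < t(m)` of natural numbers. -/
def J (m : ℕ) : Set (Fin m → ℕ) := {t | StrictMono t}

/-- `x(m, a, t, f) = a(1) f(t(1)) a(2) f(t(2)) ⋯ a(m) f(t(m)) a(m+1)`. -/
def x [Semigroup S] : (m : ℕ) → (Fin (m + 1) → S) → (Fin m → ℕ) → (ℕ → S) → S
  | 0, a, _, _ => a 0
  | m + 1, a, t, f =>
      x m (fun i => a i.castSucc) (fun i => t i.castSucc) f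
        * (f (t (Fin.last m)) * a (Fin.last (m + 1)))

/-- The ordered product `y(0) y(1) ⋯ y(n)` of `n + 1` elements of a semigroup. -/
def orderedProd [Semigroup S] : (n : ℕ) → (Fin (n + 1) → S) → S
  | 0, y => y 0
  | n + 1, y => orderedProd n (fun i => y i.castSucc) * y (Fin.last (n + 1))

/-- A finite set `F` of sequences in `S` is `𝓕`-good if for every `V ∈ 𝓕`, arbitrarily far out,
there is a single pattern `(a, t)` with `x(m, a, t, f) ∈ V` simultaneously for all `f ∈ F`. -/
def IsGood [Semigroup S] (𝓕 : Filter S) (F : Finset (ℕ → S)) : Prop :=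
  ∀ V ∈ 𝓕, ∀ k : ℕ, ∃ (m : ℕ) (hm : 0 < m) (a : Fin (m + 1) → S), ∃ t ∈ J m,
    k < t ⟨0, hm⟩ ∧ ∀ f ∈ F, x m a t f ∈ V

/-- `P_f^𝓕`: the nonempty finite `𝓕`-good sets of sequences in `S`. -/
def GoodSets [Semigroup S] (𝓕 : Filter S) : Set (Finset (ℕ → S)) :=
  {F | F.Nonempty ∧ IsGood 𝓕 F}

end FilterCentral

/-!
Let `p` be the given idempotent in the smallest ideal of the compact right topological semigroup
`T = closure 𝓕`. There are two ingredients.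

*Members of `p` contain patterns.* For a good set `F`, consider in the product `T ^ F` the set
`patternLimits 𝓕 F j` of limits of the tuples `(x m a t f)_{f ∈ F}` with `m ≥ j` and times tending
to infinity. Concatenating two patterns, the second with later times, gives a pattern, so for
`j = 0` this is a closed subsemigroup `E` and for `j = 1` a closed ideal `I` of `E`
(`mul_mem_patternLimits`). Goodness of `F` makes `I` nonempty
(`IsGood.nonempty_patternLimits`), and the constant tuple `c = (p, …, p)` lies in `E`, the bare
coefficients being the patterns of length `0`. The compact semigroup `I * c` contains an idempotent
`u * c`. As `p` is in the smallest ideal of `T`, each coordinate of `u * c` is a right identity for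
`p` (`mul_eq_self_of_mem_smallestIdeal`, from the existence of minimal left ideals), so
`c = c * (u * c)` lies in `I`. Hence every `A ∈ p` contains the evaluations at all `f ∈ F` of a
single pattern with arbitrarily late times (`IsMinimalIdempotent.exists_pattern`).

*Recursion along `⊂`.* Since `p` is idempotent, `C r` can be replaced by `(C r)⋆ ∈ p`, for which
`s⁻¹ (C r)⋆ ∈ p` whenever `s ∈ (C r)⋆`. Below a good set `F` there are finitely many good
sets and finitely many products along chains of them. If those already lie in the relevant
`(C r)⋆`, the set of `t ∈ (C |F|)⋆` that keep each of them there after multiplication by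
`t` on the right is a member of `p`, and a pattern with evaluations in it, later than all earlier
ones, is a valid choice for `F` (`exists_extends`).
-/

namespace FilterCentral

variable {S : Type*}

/-! ### Minimal idempotents of compact right topological semigroups -/

section Minimal

variable {M : Type*} [Semigroup M] [TopologicalSpace M] [T2Space M]

/-- A compact subsemigroup in which right translations are continuous has a minimal left
ideal `L`; minimality is expressed as `l ∈ T * (u * l)` for `l ∈ L`, `u ∈ T`. -/
theorem exists_minimal_left_ideal (hcont : ∀ r : M, Continuous (· * r)) {T : Set M}
    (hne : T.Nonempty) (hT : IsCompact T) (hmul : ∀ p ∈ T, ∀ q ∈ T, p * q ∈ T) :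
    ∃ L : Set M, L ⊆ T ∧ L.Nonempty ∧ (∀ u ∈ T, ∀ l ∈ L, u * l ∈ L) ∧
      ∀ u ∈ T, ∀ l ∈ L, ∃ s ∈ T, l = s * (u * l) := by
  let X : Set (Set M) :=
    {L | L ⊆ T ∧ L.Nonempty ∧ IsClosed L ∧ ∀ u ∈ T, ∀ l ∈ L, u * l ∈ L}
  -- A minimal closed left ideal suffices: it equals the left ideal generated by each of its
  -- elements, since that ideal is the image of `T` under a right translation, hence compact.
  obtain ⟨L, hL⟩ : ∃ L, Minimal (· ∈ X) L := by
    refine zorn_superset X fun c hcX hc => ?_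
    rcases c.eq_empty_or_nonempty with rfl | hcne
    · exact ⟨T, ⟨subset_rfl, hne, hT.isClosed, hmul⟩, by simp⟩
    refine ⟨⋂₀ c, ⟨?_, ?_, isClosed_sInter fun s hs => (hcX hs).2.2.1, ?_⟩,
      fun s hs => Set.sInter_subset_of_mem hs⟩
    · obtain ⟨s, hs⟩ := hcne
      exact (Set.sInter_subset_of_mem hs).trans (hcX hs).1
    · have := hcne.to_subtype
      exact IsCompact.nonempty_sInter_of_directed_nonempty_isCompact_isClosed
        (IsChain.directedOn hc.symm) (fun s hs => (hcX hs).2.1)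
        (fun s hs => hT.of_isClosed_subset (hcX hs).2.2.1 (hcX hs).1)
        (fun s hs => (hcX hs).2.2.1)
    · exact fun u hu l hl s hs => (hcX hs).2.2.2 u hu l (hl s hs)
  obtain ⟨hLT, hLne, -, hLmul⟩ := hL.prop
  refine ⟨L, hLT, hLne, hLmul, fun u hu l hl => ?_⟩
  have hul := hLmul u hu l hl
  have hX : (· * (u * l)) '' T ∈ X := by
    refine ⟨?_, hne.image _, (hT.image (hcont _)).isClosed, ?_⟩
    · rintro _ ⟨s, hs, rfl⟩
      exact hmul s hs _ (hLT hul)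
    · rintro v hv _ ⟨s, hs, rfl⟩
      exact ⟨v * s, hmul v hv s hs, mul_assoc _ _ _⟩
  have hsub : (· * (u * l)) '' T ⊆ L := by
    rintro _ ⟨s, hs, rfl⟩
    exact hLmul s hs _ hul
  obtain ⟨s, hs, h⟩ := hL.le_of_le hX hsub hl
  exact ⟨s, hs, h.symm⟩

/-- An idempotent of the left ideal `T * p` is a right identity for `p` when `p` lies in the
smallest ideal of `T`. -/
theorem mul_eq_self_of_mem_smallestIdeal (hcont : ∀ r : M, Continuous (· * r)) {T : Set M}
    (hT : IsCompact T) (hmul : ∀ p ∈ T, ∀ q ∈ T, p * q ∈ T) {p u : M}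
    (hp : p ∈ smallestIdeal T) (hu : u ∈ T) (he : u * p * (u * p) = u * p) :
    p * (u * p) = p := by
  obtain ⟨L, hLT, ⟨l₀, hl₀⟩, hLmul, hmin⟩ := exists_minimal_left_ideal hcont ⟨p, hp.1⟩ hT hmul
  -- `L * T` is a two-sided ideal of `T`, hence contains `p`.
  have hI : IsIdealOf T {q | ∃ l ∈ L, ∃ t ∈ T, q = l * t} :=
    { subset := by
        rintro _ ⟨l, hl, t, ht, rfl⟩
        exact hmul l (hLT hl) t ht
      nonempty := ⟨l₀ * p, l₀, hl₀, p, hp.1, rfl⟩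
      mul_left_mem := by
        rintro v hv _ ⟨l, hl, t, ht, rfl⟩
        exact ⟨v * l, hLmul v hv l hl, t, ht, (mul_assoc _ _ _).symm⟩
      mul_right_mem := by
        rintro v hv _ ⟨l, hl, t, ht, rfl⟩
        exact ⟨l, hl, t * v, hmul t ht v hv, mul_assoc _ _ _⟩ }
  obtain ⟨l, hl, t, -, rfl⟩ := hp.2 _ hI
  obtain ⟨s, -, hs⟩ := hmin u hu l hl
  have h : l * t = s * (u * (l * t)) := by
    conv_lhs => rw [hs]
    simp only [mul_assoc]
  calc l * t * (u * (l * t)) = s * (u * (l * t)) * (u * (l * t)) := by rw [← h]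
    _ = s * (u * (l * t)) := by rw [mul_assoc, he]
    _ = l * t := h.symm

end Minimal

/-! ### The closure of a filter -/

theorem mem_closure {𝓕 : Filter S} {p : Ultrafilter S} :
    p ∈ closure 𝓕 ↔ ∀ V ∈ 𝓕, V ∈ p := by
  simp [closure]

theorem isClosed_closure (𝓕 : Filter S) : IsClosed (closure 𝓕) :=
  isClosed_biInter fun V _ => ultrafilter_isClosed_basic V

/-! ### Patterns -/

/-- A pattern `a(1) _ a(2) _ ⋯ _ a(len+1)` with coefficients in `S` whose blanks carry strictly
increasing times. Length `0`, a bare coefficient, is allowed. -/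
structure Pattern (S : Type*) where
  /-- the number of blanks -/
  len : ℕ
  /-- the coefficients around the blanks -/
  coeff : Fin (len + 1) → S
  /-- the times at which a sequence is read into the blanks -/
  time : Fin len → ℕ
  strictMono : StrictMono time

variable [Semigroup S]

/-- The product obtained by filling the blanks of a pattern with the values of `f`. -/
def Pattern.eval (P : Pattern S) (f : ℕ → S) : S :=
  x P.len P.coeff P.time f

/-- Concatenation of patterns, by induction on the length of the second one. For `n = 0` this
multiplies the last coefficient by an element of `S`; for `m = 0`, the first. -/
theorem exists_x_eq_mul {m : ℕ} (a : Fin (m + 1) → S) {t : Fin m → ℕ} (ht : StrictMono t) :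
    ∀ (n : ℕ) (b : Fin (n + 1) → S) (u : Fin n → ℕ), StrictMono u → (∀ i j, t i < u j) →
      ∃ (c : Fin (m + n + 1) → S) (v : Fin (m + n) → ℕ), StrictMono v ∧
        (∀ i, (∃ j, v i = t j) ∨ ∃ j, v i = u j) ∧
        ∀ f, x (m + n) c v f = x m a t f * x n b u f
  | 0, b, u, _, _ => by
    refine ⟨Function.update a (Fin.last m) (a (Fin.last m) * b 0), t, ht,
      fun i => Or.inl ⟨i, rfl⟩, fun f => ?_⟩
    cases m with
    | zero => simp [x]
    | succ m => simp [x, mul_assoc]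
  | n + 1, b, u, hu, htu => by
    obtain ⟨c, v, hv, hvm, hx⟩ := exists_x_eq_mul a ht n (fun i => b i.castSucc)
      (fun i => u i.castSucc) (fun i j hij => hu (by simpa using hij)) (fun i j => htu i _)
    have hlt : ∀ i, v i < u (Fin.last n) := fun i => by
      rcases hvm i with ⟨j, hj⟩ | ⟨j, hj⟩
      · rw [hj]; exact htu _ _
      · rw [hj]; exact hu (Fin.castSucc_lt_last j)
    refine ⟨Fin.snoc (α := fun _ => S) c (b (Fin.last (n + 1))),
      Fin.snoc (α := fun _ => ℕ) v (u (Fin.last n)), ?_, ?_, fun f => ?_⟩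
    · intro i j
      induction j using Fin.lastCases with
      | last =>
        induction i using Fin.lastCases with
        | last => simp
        | cast i => simpa [Fin.castSucc_lt_last] using hlt i
      | cast j =>
        induction i using Fin.lastCases with
        | last => exact fun h => absurd h (Fin.castSucc_lt_last j).not_gt
        | cast i => simpa using fun h => hv h
    · intro i
      induction i using Fin.lastCases with
      | last => exact Or.inr ⟨Fin.last n, by simp⟩
      | cast i =>
        rcases hvm i with ⟨j, hj⟩ | ⟨j, hj⟩
        · exact Or.inl ⟨j, by simpa using hj⟩
        · exact Or.inr ⟨j.castSucc, by simpa using hj⟩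
    · have h := hx f
      change x (m + n) (fun i => Fin.snoc (α := fun _ => S) c (b (Fin.last (n + 1))) i.castSucc)
          (fun i => Fin.snoc (α := fun _ => ℕ) v (u (Fin.last n)) i.castSucc) f *
        (f (Fin.snoc (α := fun _ => ℕ) v (u (Fin.last n)) (Fin.last (m + n))) *
          Fin.snoc (α := fun _ => S) c (b (Fin.last (n + 1))) (Fin.last (m + n + 1))) =
        x m a t f * (x n (fun i => b i.castSucc) (fun i => u i.castSucc) f *
          (f (u (Fin.last n)) * b (Fin.last (n + 1))))
      simp only [Fin.snoc_castSucc, Fin.snoc_last]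
      rw [h, mul_assoc]

/-- Patterns with times in order can be concatenated, the two adjacent coefficients being
multiplied together. -/
theorem Pattern.exists_eval_eq_mul (P Q : Pattern S) (h : ∀ i j, P.time i < Q.time j) :
    ∃ R : Pattern S, R.len = P.len + Q.len ∧
      (∀ i, (∃ j, R.time i = P.time j) ∨ ∃ j, R.time i = Q.time j) ∧
      ∀ f, R.eval f = P.eval f * Q.eval f := by
  obtain ⟨c, v, hv, hvm, hx⟩ :=
    exists_x_eq_mul P.coeff P.strictMono Q.len Q.coeff Q.time Q.strictMono h
  exact ⟨⟨_, c, v, hv⟩, rfl, hvm, hx⟩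

/-! ### Limits of simultaneous evaluations -/

/-- The tuples in `(closure 𝓕) ^ F` that are limits, for times tending to infinity, of the
simultaneous evaluations `(P.eval f)_{f ∈ F}` of patterns `P` of length at least `j`. The
case `j = 1` is the ideal, inside the semigroup `j = 0`, on which the argument rests. -/
def patternLimits (𝓕 : Filter S) (F : Finset (ℕ → S)) (j : ℕ) : Set (F → Ultrafilter S) :=
  {q | (∀ f, q f ∈ closure 𝓕) ∧ ∀ (k : ℕ) (A : F → Set S), (∀ f, A f ∈ q f) →
    ∃ P : Pattern S, j ≤ P.len ∧ (∀ i, k < P.time i) ∧ ∀ f, P.eval f.1 ∈ A f}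

theorem isClosed_patternLimits (𝓕 : Filter S) (F : Finset (ℕ → S)) (j : ℕ) :
    IsClosed (patternLimits 𝓕 F j) := by
  simp only [patternLimits, Set.ofPred_and, Set.ofPred_forall]
  refine IsClosed.inter (isClosed_iInter fun f =>
    (isClosed_closure 𝓕).preimage (continuous_apply f)) ?_
  refine isClosed_iInter fun k => isClosed_iInter fun A => ?_
  refine isClosed_imp ?_ isClosed_const
  rw [Set.ofPred_forall]
  exact isOpen_iInter_of_finite fun f =>
    (ultrafilter_isOpen_basic (A f)).preimage (continuous_apply (A := fun _ => Ultrafilter S) f)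

/-- Lengths add under multiplication; hence `patternLimits 𝓕 F 0` is a semigroup in which
`patternLimits 𝓕 F 1` is a two-sided ideal. -/
theorem mul_mem_patternLimits {𝓕 : Filter S} (h𝓕 : ∀ p ∈ closure 𝓕, ∀ q ∈ closure 𝓕,
    p * q ∈ closure 𝓕) {F : Finset (ℕ → S)} {i j : ℕ} {q r : F → Ultrafilter S}
    (hq : q ∈ patternLimits 𝓕 F i) (hr : r ∈ patternLimits 𝓕 F j) :
    q * r ∈ patternLimits 𝓕 F (i + j) := by
  refine ⟨fun f => h𝓕 _ (hq.1 f) _ (hr.1 f), fun k A hA => ?_⟩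
  obtain ⟨P, hPl, hPk, hP⟩ := hq.2 k (fun f => {s | ∀ᶠ t in r f, s * t ∈ A f})
    fun f => (Ultrafilter.eventually_mul _ _ _).1 (hA f)
  -- The second pattern is read after all times of the first one.
  obtain ⟨Q, hQl, hQk, hQ⟩ := hr.2 (max k (Finset.univ.sup P.time))
    (fun f => {t | P.eval f.1 * t ∈ A f}) fun f => hP f
  obtain ⟨R, hRl, hRm, hR⟩ := P.exists_eval_eq_mul Q fun a b =>
    (Finset.le_sup (Finset.mem_univ a)).trans_lt ((le_max_right _ _).trans_lt (hQk b))
  refine ⟨R, by omega, fun a => ?_, fun f => ?_⟩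
  · rcases hRm a with ⟨b, hb⟩ | ⟨b, hb⟩
    · exact hb ▸ hPk b
    · exact hb ▸ (le_max_left _ _).trans_lt (hQk b)
  · rw [hR]; exact hQ f

theorem patternLimits_antitone (𝓕 : Filter S) (F : Finset (ℕ → S)) :
    Antitone (patternLimits 𝓕 F) := fun _ _ hij _ hq =>
  ⟨hq.1, fun k A hA => let ⟨P, hP, h⟩ := hq.2 k A hA; ⟨P, hij.trans hP, h⟩⟩

theorem const_mem_patternLimits {𝓕 : Filter S} (F : Finset (ℕ → S)) {p : Ultrafilter S}
    (hp : p ∈ closure 𝓕) : (fun _ => p) ∈ patternLimits 𝓕 F 0 := by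
  refine ⟨fun _ => hp, fun k A hA => ?_⟩
  obtain ⟨s, hs⟩ := p.nonempty_of_mem (Filter.iInter_mem.2 hA)
  exact ⟨⟨0, fun _ => s, Fin.elim0, fun i => i.elim0⟩, le_rfl, fun i => i.elim0,
    fun f => Set.mem_iInter.1 hs f⟩

theorem IsGood.exists_pattern {𝓕 : Filter S} {F : Finset (ℕ → S)} (hF : IsGood 𝓕 F)
    {V : Set S} (hV : V ∈ 𝓕) (k : ℕ) :
    ∃ P : Pattern S, 1 ≤ P.len ∧ (∀ i, k < P.time i) ∧ ∀ f ∈ F, P.eval f ∈ V := by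
  obtain ⟨m, hm, a, t, ht, hk, h⟩ := hF V hV k
  exact ⟨⟨m, a, t, ht⟩, hm,
    fun i => hk.trans_le (StrictMono.monotone ht (Fin.mk_le_of_le_val (Nat.zero_le _))), h⟩

theorem IsGood.nonempty_patternLimits {𝓕 : Filter S} {F : Finset (ℕ → S)} (hF : IsGood 𝓕 F) :
    (patternLimits 𝓕 F 1).Nonempty := by
  -- The sets of patterns supplied by goodness are directed; an ultrafilter containing all of
  -- them is pushed forward by each evaluation map.
  let B : {V // V ∈ 𝓕} × ℕ → Set (Pattern S) := fun b =>
    {P | 1 ≤ P.len ∧ (∀ i, b.2 < P.time i) ∧ ∀ f ∈ F, P.eval f ∈ b.1.1}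
  have hne : (⨅ b, 𝓟 (B b)).NeBot := by
    have : Nonempty ({V // V ∈ 𝓕} × ℕ) := ⟨⟨Set.univ, Filter.univ_mem⟩, 0⟩
    refine Filter.iInf_neBot_of_directed' ?_ fun b => ?_
    · rintro ⟨⟨V, hV⟩, k⟩ ⟨⟨W, hW⟩, l⟩
      refine ⟨⟨⟨V ∩ W, Filter.inter_mem hV hW⟩, max k l⟩, ?_, ?_⟩
      · exact Filter.principal_mono.2 fun P hP =>
          ⟨hP.1, fun i => (le_max_left _ _).trans_lt (hP.2.1 i), fun f hf => (hP.2.2 f hf).1⟩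
      · exact Filter.principal_mono.2 fun P hP =>
          ⟨hP.1, fun i => (le_max_right _ _).trans_lt (hP.2.1 i), fun f hf => (hP.2.2 f hf).2⟩
    · exact Filter.principal_neBot_iff.2 (hF.exists_pattern b.1.2 b.2)
  let 𝒰 := Ultrafilter.of (⨅ b, 𝓟 (B b))
  have h𝒰 : ∀ b, B b ∈ 𝒰 := fun b =>
    Ultrafilter.of_le _ (Filter.mem_iInf_of_mem b (Filter.mem_principal_self _))
  refine ⟨fun f => 𝒰.map fun P => P.eval f.1, fun f => mem_closure.2 fun V hV => ?_,
    fun k A hA => ?_⟩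
  · refine Ultrafilter.mem_map.2 ?_
    filter_upwards [h𝒰 ⟨⟨V, hV⟩, 0⟩] with P hP using hP.2.2 f.1 f.2
  · obtain ⟨P, hP, hPA⟩ := 𝒰.nonempty_of_mem
      (Filter.inter_mem (h𝒰 ⟨⟨Set.univ, Filter.univ_mem⟩, k⟩) (Filter.iInter_mem.2 hA))
    exact ⟨P, hP.1, hP.2.1, fun f => Set.mem_iInter.1 hPA f⟩

/-- Members of a minimal idempotent of `closure 𝓕` inherit from the members of `𝓕` the
patterns that goodness provides. -/
theorem IsMinimalIdempotent.exists_pattern {𝓕 : Filter S} (h𝓕 : ∀ p ∈ closure 𝓕,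
    ∀ q ∈ closure 𝓕, p * q ∈ closure 𝓕) {p : Ultrafilter S} (hp : IsMinimalIdempotent 𝓕 p)
    {F : Finset (ℕ → S)} (hF : IsGood 𝓕 F) {A : Set S} (hA : A ∈ p) (k : ℕ) :
    ∃ P : Pattern S, 1 ≤ P.len ∧ (∀ i, k < P.time i) ∧ ∀ f ∈ F, P.eval f ∈ A := by
  let c : F → Ultrafilter S := fun _ => p
  have hc : c ∈ patternLimits 𝓕 F 0 := const_mem_patternLimits F hp.1.1
  have hcont : ∀ r : F → Ultrafilter S, Continuous (· * r) := fun r =>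
    continuous_pi fun f => (Ultrafilter.continuous_mul_left (r f)).comp (continuous_apply f)
  obtain ⟨_, ⟨u, hu, rfl⟩, he⟩ := exists_idempotent_in_compact_subsemigroup hcont
    ((· * c) '' patternLimits 𝓕 F 1) (hF.nonempty_patternLimits.image _)
    ((isClosed_patternLimits 𝓕 F 1).isCompact.image (hcont c)) (by
      rintro _ ⟨u, hu, rfl⟩ _ ⟨v, hv, rfl⟩
      refine ⟨u * c * v, ?_, mul_assoc _ _ _⟩
      exact patternLimits_antitone 𝓕 F (by norm_num)
        (mul_mem_patternLimits h𝓕 (mul_mem_patternLimits h𝓕 hu hc) hv))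
  -- Each coordinate of the idempotent `u * c` is a right identity for `p`, so `c` is pulled
  -- into the ideal of limits of patterns of positive length.
  have hcu : c * (u * c) = c := funext fun f =>
    mul_eq_self_of_mem_smallestIdeal Ultrafilter.continuous_mul_left
      (isClosed_closure 𝓕).isCompact h𝓕 hp.1 (hu.1 f) (congrFun he f)
  have hmem : c ∈ patternLimits 𝓕 F 1 := by
    rw [← hcu]
    simpa using mul_mem_patternLimits h𝓕 hc (mul_mem_patternLimits h𝓕 hu hc)
  obtain ⟨P, hl, hk, h⟩ := hmem.2 k (fun _ => A) fun _ => hA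
  exact ⟨P, hl, hk, fun f hf => h ⟨f, hf⟩⟩

/-! ### The recursive choice -/

/-- `A⋆ = {s ∈ A | s⁻¹ A ∈ p}`. For `p` idempotent and `A ∈ p`, this is again a member of `p`,
and so is `s⁻¹ A⋆` for every `s ∈ A⋆`. -/
def star (p : Ultrafilter S) (A : Set S) : Set S :=
  {s | s ∈ A ∧ ∀ᶠ t in p, s * t ∈ A}

theorem star_mem {p : Ultrafilter S} (hp : p * p = p) {A : Set S} (hA : A ∈ p) :
    star p A ∈ p := by
  refine Filter.inter_mem hA ?_
  have h : ∀ᶠ s in (p * p : Ultrafilter S), s ∈ A := by rwa [hp]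
  exact (Ultrafilter.eventually_mul _ _ _).1 h

theorem eventually_mul_mem_star {p : Ultrafilter S} (hp : p * p = p) {A : Set S} {s : S}
    (hs : s ∈ star p A) : ∀ᶠ t in p, s * t ∈ star p A := by
  have h : ∀ᶠ t in (p * p : Ultrafilter S), s * t ∈ A := by rw [hp]; exact hs.2
  filter_upwards [hs.2, (Ultrafilter.eventually_mul _ _ _).1 h] with t ht htu
  refine ⟨ht, ?_⟩
  filter_upwards [htu] with t' h'
  rwa [mul_assoc]

/-- The data attached to a good set `F`: a pattern of positive length together with the products
along the chains of good sets ending at `F`. A pair `(r, y)` records a product `y` along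
a chain whose first set has `r` elements, and `y` is kept in `(C r)⋆`. -/
structure Stage (p : Ultrafilter S) (C : ℕ → Set S) where
  /-- the pattern chosen for the good set -/
  pattern : Pattern S
  len_pos : 0 < pattern.len
  /-- the recorded products -/
  products : Set (ℕ × S)
  finite : products.Finite
  mem_star : ∀ z ∈ products, z.2 ∈ star p (C z.1)

/-- `F`'s stage `d` extends the stages `h` of the good sets strictly below `F`. -/
structure Extends {𝓕 : Filter S} {p : Ultrafilter S} {C : ℕ → Set S} (F : GoodSets 𝓕)
    (h : ∀ G : GoodSets 𝓕, G.1 ⊂ F.1 → Stage p C) (d : Stage p C) : Prop where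
  time_lt : ∀ G hG i j, (h G hG).pattern.time i < d.pattern.time j
  singleton_mem : ∀ f ∈ F.1, (F.1.card, d.pattern.eval f) ∈ d.products
  mul_mem : ∀ G hG, ∀ z ∈ (h G hG).products, ∀ f ∈ F.1,
    (z.1, z.2 * d.pattern.eval f) ∈ d.products

theorem exists_extends {𝓕 : Filter S} (h𝓕 : ∀ p ∈ closure 𝓕, ∀ q ∈ closure 𝓕,
    p * q ∈ closure 𝓕) {p : Ultrafilter S} (hp : IsMinimalIdempotent 𝓕 p) {C : ℕ → Set S}
    (hC : ∀ n, 1 ≤ n → C n ∈ p) (F : GoodSets 𝓕)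
    (h : ∀ G : GoodSets 𝓕, G.1 ⊂ F.1 → Stage p C) : ∃ d, Extends F h d := by
  have : Finite {G : GoodSets 𝓕 // G.1 ⊂ F.1} :=
    Finite.of_injective
      (fun G => (⟨G.1.1, Finset.mem_powerset.2 G.2.subset⟩ : {s // s ∈ F.1.powerset}))
      fun G H e => Subtype.ext (Subtype.ext (congrArg (fun s => s.1) e))
  let Z : Set (ℕ × S) := ⋃ G : {G : GoodSets 𝓕 // G.1 ⊂ F.1}, (h G.1 G.2).products
  have hZ : Z.Finite := Set.finite_iUnion fun G => (h G.1 G.2).finite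
  have hZs : ∀ z ∈ Z, z.2 ∈ star p (C z.1) := fun z hz =>
    let ⟨G, hG⟩ := Set.mem_iUnion.1 hz
    (h G.1 G.2).mem_star z hG
  obtain ⟨k, hk⟩ : ∃ k, ∀ (G : {G : GoodSets 𝓕 // G.1 ⊂ F.1}) i,
      (h G.1 G.2).pattern.time i ≤ k := by
    obtain ⟨k, hk⟩ := (Set.finite_range fun z :
      Σ G : {G : GoodSets 𝓕 // G.1 ⊂ F.1}, Fin (h G.1 G.2).pattern.len =>
        (h z.1.1 z.1.2).pattern.time z.2).bddAbove
    exact ⟨k, fun G i => hk ⟨⟨G, i⟩, rfl⟩⟩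
  have hA : star p (C F.1.card) ∩ ⋂ z ∈ Z, {t | z.2 * t ∈ star p (C z.1)} ∈ p :=
    Filter.inter_mem (star_mem hp.2 (hC _ F.2.1.card_pos))
      ((Filter.biInter_mem hZ).2 fun z hz => eventually_mul_mem_star hp.2 (hZs z hz))
  obtain ⟨P, hl, hPk, hP⟩ := hp.exists_pattern h𝓕 F.2.2 hA k
  refine ⟨⟨P, hl, (fun f => (F.1.card, P.eval f)) '' F.1 ∪
    Set.image2 (fun z f => (z.1, z.2 * P.eval f)) Z F.1,
    (F.1.finite_toSet.image _).union (hZ.image2 _ F.1.finite_toSet), ?_⟩, ?_, ?_, ?_⟩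
  · rintro _ (⟨f, hf, rfl⟩ | ⟨z, hz, f, hf, rfl⟩)
    · exact (hP f hf).1
    · exact Set.mem_iInter₂.1 (hP f hf).2 z hz
  · exact fun G hG i j => (hk ⟨G, hG⟩ i).trans_lt (hPk j)
  · exact fun f hf => Or.inl ⟨f, hf, rfl⟩
  · exact fun G hG z hz f hf =>
      Or.inr ⟨z, Set.mem_iUnion.2 ⟨⟨G, hG⟩, hz⟩, f, hf, rfl⟩

theorem exists_stages {𝓕 : Filter S} (h𝓕 : ∀ p ∈ closure 𝓕, ∀ q ∈ closure 𝓕,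
    p * q ∈ closure 𝓕) {p : Ultrafilter S} (hp : IsMinimalIdempotent 𝓕 p) {C : ℕ → Set S}
    (hC : ∀ n, 1 ≤ n → C n ∈ p) :
    ∃ d : GoodSets 𝓕 → Stage p C, ∀ F, Extends F (fun G _ => d G) (d F) := by
  choose step hstep using exists_extends h𝓕 hp hC
  have wf : WellFounded fun G F : GoodSets 𝓕 => G.1 ⊂ F.1 := InvImage.wf Subtype.val wellFounded_lt
  refine ⟨wf.fix step, fun F => ?_⟩
  rw [wf.fix_eq]
  exact hstep F _

theorem orderedProd_mem_products {𝓕 : Filter S} {p : Ultrafilter S} {C : ℕ → Set S}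
    {d : GoodSets 𝓕 → Stage p C} (hd : ∀ F, Extends F (fun G _ => d G) (d F)) :
    ∀ (n : ℕ) (G : Fin (n + 1) → GoodSets 𝓕) (f : Fin (n + 1) → ℕ → S),
      (∀ i j, i < j → (G i).1 ⊂ (G j).1) → (∀ i, f i ∈ (G i).1) →
      ((G 0).1.card, orderedProd n fun i => (d (G i)).pattern.eval (f i)) ∈
        (d (G (Fin.last n))).products
  | 0, G, f, _, hf => (hd (G 0)).singleton_mem (f 0) (hf 0)
  | n + 1, G, f, hG, hf =>
    (hd (G (Fin.last (n + 1)))).mul_mem (G (Fin.last n).castSucc) (hG _ _ (Fin.castSucc_lt_last _))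
      _ (orderedProd_mem_products hd n (fun i => G i.castSucc) (fun i => f i.castSucc)
        (fun i j hij => hG _ _ (by simpa using hij)) fun i => hf _) _ (hf _)

end FilterCentral

theorem theorem21 {S : Type*} [Semigroup S] (𝓕 : Filter S)
    (h𝓕 : ∀ p ∈ FilterCentral.closure 𝓕, ∀ q ∈ FilterCentral.closure 𝓕,
      p * q ∈ FilterCentral.closure 𝓕)
    (C : ℕ → Set S)
    (hC : ∃ p : Ultrafilter S, FilterCentral.IsMinimalIdempotent 𝓕 p ∧ ∀ n, 1 ≤ n → C n ∈ p) :
    ∃ (m : FilterCentral.GoodSets 𝓕 → ℕ) (hm : ∀ F, 0 < m F)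
      (α : (F : FilterCentral.GoodSets 𝓕) → Fin (m F + 1) → S)
      (τ : (F : FilterCentral.GoodSets 𝓕) → Fin (m F) → ℕ),
      (∀ F, τ F ∈ FilterCentral.J (m F)) ∧
      (∀ F G : FilterCentral.GoodSets 𝓕, G.1 ⊂ F.1 →
        τ G ⟨m G - 1, Nat.sub_lt (hm G) Nat.one_pos⟩ < τ F ⟨0, hm F⟩) ∧
      (∀ (n : ℕ) (G : Fin (n + 1) → FilterCentral.GoodSets 𝓕) (f : Fin (n + 1) → ℕ → S),
        (∀ i j, i < j → (G i).1 ⊂ (G j).1) → (∀ i, f i ∈ (G i).1) →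
        FilterCentral.orderedProd n
          (fun i => FilterCentral.x (m (G i)) (α (G i)) (τ (G i)) (f i)) ∈ C (G 0).1.card) := by

  obtain ⟨p, hp, hCp⟩ := hC
  obtain ⟨d, hd⟩ := FilterCentral.exists_stages h𝓕 hp hCp
  refine ⟨fun F => (d F).pattern.len, fun F => (d F).len_pos, fun F => (d F).pattern.coeff,
    fun F => (d F).pattern.time, fun F => (d F).pattern.strictMono,
    fun F G hGF => (hd F).time_lt G hGF _ _, fun n G f hG hf => ?_⟩
  exact ((d _).mem_star _ (FilterCentral.orderedProd_mem_products hd n G f hG hf)).1
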